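/- Let $(\Omega,\mathcal F_T,P)$ be a probability space and let $\mathcal H\subseteq\mathcal F\subseteq\mathcal F_T$ be complete $\sigma$-algebras. Let $y\in L^0(\mathbb R^d,\mathcal H)$ and $Y\in L^0(\mathbb R^d,\mathcal F)$ be non-negative (coordinatewise, a.s.), and let $g:\Omega\times\mathbb R^d\to[-\infty,+\infty]$ be such that $g(Y):\omega\mapsto g(\omega,Y(\omega))$ is an (a.s.) real-valued $\mathcal F$-measurable random variable. Products of vectors are scalar products. Put $$\mathcal P(g)=\{x\in L^0(\mathbb R,\mathcal H):\ \exists\,\theta\in L^0(\mathbb R^d,\mathcal H),\ x+\theta(Y-y)\ge g(Y)\ \text{a.s.}\},\qquad p(g)=\operatorname{ess\,inf}\mathcal P(g)\in[-\infty,+\infty].$$ For a $\sigma$-algebra $\mathcal H$, $\operatorname{ess\,sup}_{\mathcal H}X$ is the a.s. smallest $[-\infty,\infty]$-valued $\mathcal H$-measurable function that is a.s. $\ge X$. Let $K(\omega)=\operatorname{supp}_{\mathcal H}Y(\omega)$ be the intersection of all closed sets of full measure for a regular version (any one) of the conditional law of $Y$ given $\mathcal H$. Let $\operatorname{conv}K$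 be its convex hull and $\overline{\operatorname{conv}}\,K$ the closure of $\operatorname{conv}K$. For a set $C$ put $\delta_C=0$ on $C$ and $\delta_C=+\infty$ off $C$. 1. The set of super-hedging prices is $$\mathcal P(g)=\Big(\big\{\operatorname{ess\,sup}_{\mathcal H}(g(Y)-\theta Y)+\theta y:\ \theta\in L^0(\mathbb R^d,\mathcal H)\big\}+L^0(\mathbb R_+,\mathcal H)\Big)\cap L^0(\mathbb R,\mathcal H).$$ 2. Suppose that $g$ is an $\mathcal H$-normal integrand, i.e. $\omega\mapsto\{(z,r)\in\mathbb R^d\times\mathbb R: g(\omega,z)\le r\}$ is closed-valued and $\mathcal H$-measurable (for every open $O$, the set of $\omega$ at which this set meets $O$ is in $\mathcal H$). Let $f(\omega,z)=-g(\omega,z)$ for $z\in K(\omega)$, $f(\omega,z)=+\infty$ for $z\notin K(\omega)$, and let $f^*(\omega,x)=\sup_{z\in\mathbb R^d}(xz-f(\omega,z))$. Then for every $\theta\in L^0(\mathbb R^d,\mathcal H)$, $$\operatorname{ess\,sup}_{\mathcal H}(g(Y)-\theta Y)=\sup_{z\in K}\big(g(z)-\theta z\big)=f^*(-\theta)\quad\text{a.s.}$$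 3. Suppose moreover that a.s. $g(\omega,\cdot)$ is proper (nowhere $-\infty$, not identically $+\infty$) and that a.s. there is a finite concave function $\varphi$ on $\operatorname{conv}K(\omega)$ with $g(\omega,\cdot)\le\varphi$ on $\operatorname{conv}K(\omega)$. Let $f^{**}(\omega,x)=\sup_{z}(xz-f^*(\omega,z))$, let $\operatorname{conc}(g,K)(x)$ be the infimum of $v(x)$ over all concave $v:\mathbb R^d\to[-\infty,\infty]$ with $v\ge g$ on $K$, and let $\overline{\operatorname{conc}}(g,K)(x)=\limsup_{u\to x}\operatorname{conc}(g,K)(u)$ (with $u=x$ allowed) be its upper closure. Then a.s. $$p(g)=-f^{**}(y)=\overline{\operatorname{conc}}(g,K)(y)-\delta_{\overline{\operatorname{conv}}\,K}(y)$$ $$=\inf\{\alpha y+\beta:\ \alpha\in\mathbb R^d,\ \beta\in\mathbb R,\ \alpha x+\beta\ge g(x)\ \forall x\in K\}-\delta_{\overline{\operatorname{conv}}\,K}(y).$$ On the event $\{y\notin\overline{\operatorname{conv}}\,K\setminus\operatorname{conv}K\}$ (everything if $\operatorname{conv}K$ is a.s. closed, e.g. if $d=1$ or $K$ is bounded), $\overline{\operatorname{conv}}\,K$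 may be replaced by $\operatorname{conv}K$ in both formulas. -/

import Mathlib

open MeasureTheory ProbabilityTheory Filter Topology
open scoped ENNReal RealInnerProductSpace

noncomputable section

namespace SuperHedging

/-! ### Conditional essential supremum and infimum -/

section EssSup

variable {Ω : Type*}

/-- `s` is an essential supremum of the family `Γ` conditionally to the sub-σ-algebra `m`: the
almost surely smallest `m`-measurable function that dominates every member of `Γ` almost surely. -/
structure IsCondEssSup (m : MeasurableSpace Ω) {m₀ : MeasurableSpace Ω} (P : Measure Ω) (Γ : Set (Ω → EReal))
    (s : Ω → EReal) : Prop where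
  measurable : Measurable[m] s
  le : ∀ γ ∈ Γ, γ ≤ᵐ[P] s
  least : ∀ ζ : Ω → EReal, Measurable[m] ζ → (∀ γ ∈ Γ, γ ≤ᵐ[P] ζ) → s ≤ᵐ[P] ζ

/-- The conditional essential supremum; it is unique up to almost sure equality. -/
def condEssSup (m : MeasurableSpace Ω) {m₀ : MeasurableSpace Ω} (P : Measure Ω)
    (Γ : Set (Ω → EReal)) : Ω → EReal :=
  Classical.epsilon (IsCondEssSup m P Γ)

/-- The conditional essential infimum, defined symmetrically. -/
def condEssInf (m : MeasurableSpace Ω) {m₀ : MeasurableSpace Ω} (P : Measure Ω)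
    (Γ : Set (Ω → EReal)) : Ω → EReal :=
  fun ω => - condEssSup m P ((fun γ ω => - γ ω) '' Γ) ω

theorem exists_isCondEssSup {m m₀ : MeasurableSpace Ω} (hm : m ≤ m₀) (P : Measure Ω)
    [IsFiniteMeasure P] (Γ : Set (Ω → EReal)) : ∃ s, IsCondEssSup m P Γ s := by
  let φ : EReal → ℝ≥0∞ := fun x => (ENNReal.orderIsoIicOneBirational (EReal.expOrderIso x) : ℝ≥0∞)
  have φmono : StrictMono φ := fun a b hab => by
    have := ENNReal.orderIsoIicOneBirational.strictMono (EReal.expOrderIso.strictMono hab)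
    exact this
  have φle : ∀ x, φ x ≤ 1 := fun x =>
    (ENNReal.orderIsoIicOneBirational (EReal.expOrderIso x)).2
  have φmeas : Measurable φ := φmono.monotone.measurable
  let S : Set (Ω → EReal) := {ζ | Measurable[m] ζ ∧ ∀ γ ∈ Γ, γ ≤ᵐ[P] ζ}
  have hS : ((fun ζ : Ω → EReal => ∫⁻ ω, φ (ζ ω) ∂P) '' S).Nonempty :=
    ⟨_, ⟨fun _ => ⊤, ⟨measurable_const, fun γ _ => Eventually.of_forall fun _ => le_top⟩, rfl⟩⟩
  obtain ⟨u, -, hu, huS⟩ := exists_seq_tendsto_sInf hS (OrderBot.bddBelow _)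
  choose ζ hζ hζu using huS
  have hs : (fun ω => ⨅ n, ζ n ω) ∈ S := by
    refine ⟨Measurable.iInf fun n => (hζ n).1, fun γ hγ => ?_⟩
    filter_upwards [ae_all_iff.2 fun n => (hζ n).2 γ hγ] with ω h using le_iInf h
  refine ⟨fun ω => ⨅ n, ζ n ω, hs.1, hs.2, fun ξ hξ hξΓ => ?_⟩
  have hmin : (fun ω => (⨅ n, ζ n ω) ⊓ ξ ω) ∈ S := by
    refine ⟨hs.1.inf hξ, fun γ hγ => ?_⟩
    filter_upwards [hs.2 γ hγ, hξΓ γ hγ] with ω h1 h2 using le_inf h1 h2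
  have hle : ∫⁻ ω, φ (⨅ n, ζ n ω) ∂P ≤ ∫⁻ ω, φ ((⨅ n, ζ n ω) ⊓ ξ ω) ∂P := by
    refine le_trans ?_ (sInf_le (Set.mem_image_of_mem (fun ζ : Ω → EReal => ∫⁻ ω, φ (ζ ω) ∂P) hmin))
    refine ge_of_tendsto' hu fun n => ?_
    rw [← hζu n]
    exact lintegral_mono fun ω => φmono.monotone (iInf_le _ n)
  have hae := ae_eq_of_ae_le_of_lintegral_le (μ := P)
    (f := fun ω => φ ((⨅ n, ζ n ω) ⊓ ξ ω)) (g := fun ω => φ (⨅ n, ζ n ω))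
    (Eventually.of_forall fun ω => φmono.monotone inf_le_left)
    (((lintegral_mono fun ω => φle _).trans_lt (by simp)).ne)
    (Measurable.aemeasurable (φmeas.comp (Measurable.mono hs.1 hm le_rfl))) hle
  filter_upwards [hae] with ω h
  exact inf_eq_left.1 (φmono.injective h)

theorem isCondEssSup_condEssSup {m m₀ : MeasurableSpace Ω} (hm : m ≤ m₀) (P : Measure Ω)
    [IsFiniteMeasure P] (Γ : Set (Ω → EReal)) : IsCondEssSup m P Γ (condEssSup m P Γ) :=
  Classical.epsilon_spec (exists_isCondEssSup hm P Γ)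

theorem IsCondEssSup.ae_eq {m m₀ : MeasurableSpace Ω} {P : Measure Ω} {Γ : Set (Ω → EReal)}
    {s t : Ω → EReal} (hs : IsCondEssSup m P Γ s) (ht : IsCondEssSup m P Γ t) : s =ᵐ[P] t :=
  (hs.least t ht.measurable ht.le).antisymm (ht.least s hs.measurable hs.le)

end EssSup

/-! ### Conditional law and conditional support -/

/-- The support of a probability measure `μ` on `ℝᵈ`: the intersection of all closed sets of full
measure. The conditional support of `Y` is `ω ↦ lawSupport (κ ω)` for a regular version `κ` of the
conditional law of `Y`. -/
def lawSupport {d : ℕ} (μ : Measure (EuclideanSpace ℝ (Fin d))) :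
    Set (EuclideanSpace ℝ (Fin d)) :=
  ⋂₀ {A | IsClosed A ∧ μ A = 1}

/-- The Markov kernel `κ` is a regular version of the conditional law of `Y` given `H`. -/
def IsRegularCondLaw {Ω : Type*} {d : ℕ} (H : MeasurableSpace Ω) [MeasurableSpace Ω]
    (P : Measure Ω) (Y : Ω → EuclideanSpace ℝ (Fin d))
    (κ : Kernel[H] Ω (EuclideanSpace ℝ (Fin d))) : Prop :=
  IsMarkovKernel κ ∧ ∀ A : Set (EuclideanSpace ℝ (Fin d)), MeasurableSet A →
    (fun ω => (κ ω).real A) =ᵐ[P] P⟦Y ⁻¹' A | H⟧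

/-! ### Convex analysis -/

section Convex

variable {d : ℕ}

/-- The indicator `δ_C` of convex analysis: `0` on `C` and `+∞` elsewhere. -/
def indicatorFn (C : Set (EuclideanSpace ℝ (Fin d))) (z : EuclideanSpace ℝ (Fin d)) : EReal :=
  open Classical in if z ∈ C then 0 else ⊤

/-- The Fenchel-Legendre conjugate `f*(x) = sup_z (xz - f(z))`. -/
def conjugate (f : EuclideanSpace ℝ (Fin d) → EReal) (x : EuclideanSpace ℝ (Fin d)) : EReal :=
  ⨆ z, ((⟪x, z⟫ : ℝ) : EReal) - f z

/-- `-g + δ_K`, equal to `-g` on `K` and to `+∞` off `K` (whatever the value of `g` there). -/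
def negOn (g : EuclideanSpace ℝ (Fin d) → EReal) (K : Set (EuclideanSpace ℝ (Fin d)))
    (z : EuclideanSpace ℝ (Fin d)) : EReal :=
  open Classical in if z ∈ K then - g z else ⊤

/-- `g` is proper: not identically `+∞`, and nowhere `-∞`. -/
def IsProper (g : EuclideanSpace ℝ (Fin d) → EReal) : Prop :=
  (∃ x, g x < ⊤) ∧ ∀ x, ⊥ < g x

/-- An extended real-valued function is concave if its hypograph is convex. -/
def IsConcave (v : EuclideanSpace ℝ (Fin d) → EReal) : Prop :=
  Convex ℝ {p : EuclideanSpace ℝ (Fin d) × ℝ | (p.2 : EReal) ≤ v p.1}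

/-- The concave envelope `conc(g, K)` of `g` relative to `K`. -/
def relConc (g : EuclideanSpace ℝ (Fin d) → EReal) (K : Set (EuclideanSpace ℝ (Fin d)))
    (x : EuclideanSpace ℝ (Fin d)) : EReal :=
  sInf {t | ∃ v : EuclideanSpace ℝ (Fin d) → EReal,
    IsConcave v ∧ (∀ z ∈ K, g z ≤ v z) ∧ t = v x}

/-- The upper closure of `h`; the neighbourhoods of `x` contain `x`. -/
def uscHull (h : EuclideanSpace ℝ (Fin d) → EReal) (x : EuclideanSpace ℝ (Fin d)) : EReal :=
  limsup h (𝓝 x)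

/-- The infimum at `x` of the affine functions that dominate `g` on `K`. -/
def affineInf (g : EuclideanSpace ℝ (Fin d) → EReal) (K : Set (EuclideanSpace ℝ (Fin d)))
    (x : EuclideanSpace ℝ (Fin d)) : EReal :=
  sInf {t | ∃ (α : EuclideanSpace ℝ (Fin d)) (β : ℝ),
    (∀ z ∈ K, g z ≤ ((⟪α, z⟫ + β : ℝ) : EReal)) ∧ t = ((⟪α, x⟫ + β : ℝ) : EReal)}

end Convex

/-! ### The market -/

section Market

variable {Ω : Type*} {d : ℕ}

/-- `g` is an `H`-normal integrand: its epigraphical mapping `ω ↦ epi g(ω, ·)` is closed-valued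
and `H`-measurable (inverse images of open sets belong to `H`). -/
structure IsNormalIntegrand (H : MeasurableSpace Ω)
    (g : Ω → EuclideanSpace ℝ (Fin d) → EReal) : Prop where
  closed_epi : ∀ ω, IsClosed {p : EuclideanSpace ℝ (Fin d) × ℝ | g ω p.1 ≤ (p.2 : EReal)}
  measurable_epi : ∀ O : Set (EuclideanSpace ℝ (Fin d) × ℝ), IsOpen O →
    MeasurableSet[H] {ω | ∃ p ∈ O, g ω p.1 ≤ (p.2 : EReal)}

/-- The set of super-hedging prices of the claim `Z`: the `H`-measurable initial values `x` of
portfolios with `x + θ(Y - y) ≥ Z` almost surely for some `H`-measurable strategy `θ`. -/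
def superHedgingPrices (H : MeasurableSpace Ω) [MeasurableSpace Ω] (P : Measure Ω)
    (y Y : Ω → EuclideanSpace ℝ (Fin d)) (Z : Ω → ℝ) : Set (Ω → ℝ) :=
  {x | Measurable[H] x ∧ ∃ θ : Ω → EuclideanSpace ℝ (Fin d), Measurable[H] θ ∧
    ∀ᵐ ω ∂P, Z ω ≤ x ω + ⟪θ ω, Y ω - y ω⟫}

/-- The infimum super-hedging cost of `Z`: the (unconditional) essential infimum of the set of
super-hedging prices, with values in `[-∞, +∞]`. -/
def superHedgingCost (H : MeasurableSpace Ω) [m₀ : MeasurableSpace Ω] (P : Measure Ω)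
    (y Y : Ω → EuclideanSpace ℝ (Fin d)) (Z : Ω → ℝ) : Ω → EReal :=
  condEssInf m₀ P ((fun x ω => (x ω : EReal)) '' superHedgingPrices H P y Y Z)

/-- `esssup_H (Z - θY)`. -/
def hedgeEssSup (H : MeasurableSpace Ω) [MeasurableSpace Ω] (P : Measure Ω)
    (Y : Ω → EuclideanSpace ℝ (Fin d)) (Z : Ω → ℝ) (θ : Ω → EuclideanSpace ℝ (Fin d)) :
    Ω → EReal :=
  condEssSup H P {fun ω => ((Z ω - ⟪θ ω, Y ω⟫ : ℝ) : EReal)}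

end Market

end SuperHedging

end

/-! With strategy `θ`, a price `x` super-hedges exactly when the `H`-measurable variable `x - θy`
dominates `Z - θY`, hence when it dominates `esssup_H (Z - θY)`. The description of the price set is
this rearrangement.

For a normal integrand, `z ↦ g(ω, z) - θz` is lower semicontinuous, so a bound on it by `ζ(ω)` is a
closed condition on `z`: it holds for `κ ω`-almost every `z` iff it holds on the whole support.
Disintegrating the law of `(ω, Y)` along `κ` turns this into `IsRegularCondLaw.hedgeEssSup_ae_eq`.

The cost should therefore be the pointwise infimum over `θ` of `tiltedSup + θy`. The obstacle is an
uncountable infimum with a measurable choice of `θ`. As `Y ≥ 0`, the support lies in the orthant and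
`tiltedSup` is antitone in the slope, so any slope can be raised slightly into a countable dense set
at arbitrarily small cost (`iInf_tiltedSup_eq_iInf_denseSeq`). Constant strategies then suffice, up
to a measurable switch that keeps prices finite (`superHedgingCost_ae_eq_iInf`).

The rest is deterministic. The infimum is `-f**` after `θ ↦ -θ`, and it is the infimum of affine
majorants; Hahn–Banach applied to the convex hull of the hypograph identifies this with the upper
closure of the concave envelope. The concave bound `φ` serves only to provide one affine majorant.
Tilting that majorant gives `-∞` off the closed convex hull, so the indicator terms change nothing.
-/

noncomputable section

namespace SuperHedging

/-! ### Affine majorants and biconjugates -/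

section ConvexAnalysis

/-- A finite concave function has a supergradient at every interior point of its domain. -/
theorem _root_.ConcaveOn.exists_supergradient {V : Type*} [NormedAddCommGroup V] [NormedSpace ℝ V]
    [FiniteDimensional ℝ V] {C : Set V} {ψ : V → ℝ} (hψ : ConcaveOn ℝ C ψ)
    (h0 : (0 : V) ∈ interior C) : ∃ a : V →L[ℝ] ℝ, ∀ v ∈ C, ψ v ≤ ψ 0 + a v := by
  have hcont := hψ.continuousOn_interior
  have hψi : ConcaveOn ℝ (interior C) ψ := hψ.subset interior_subset hψ.1.interior
  have hopen : IsOpen {p : V × ℝ | p.1 ∈ interior C ∧ p.2 < ψ p.1} := by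
    have hU : IsOpen {p : V × ℝ | p.1 ∈ interior C} := isOpen_interior.preimage continuous_fst
    have hc : ContinuousOn (fun p : V × ℝ => ψ p.1 - p.2) {p : V × ℝ | p.1 ∈ interior C} :=
      (hcont.comp continuousOn_fst fun p hp => hp).sub continuousOn_snd
    convert hc.isOpen_inter_preimage hU isOpen_Ioi (t := Set.Ioi 0) using 1
    ext p
    simp
  -- Separate the boundary point `(0, ψ 0)` from the open strict hypograph over the interior; the
  -- separating hyperplane is not vertical because `(0, ψ 0 - 1)` lies in that hypograph.
  obtain ⟨f, hf⟩ := geometric_hahn_banach_open_point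
    hψi.convex_strict_hypograph hopen (x := ((0 : V), ψ 0)) (by simp)
  have hsplit : ∀ v r, f (v, r) = f (v, 0) + r * f (0, 1) := fun v r => by
    have : ((v, r) : V × ℝ) = (v, 0) + r • (0, 1) := by simp
    rw [this, map_add, map_smul, smul_eq_mul]
  have hb : 0 < f (0, 1) := by
    have := hf ((0 : V), ψ 0 - 1) ⟨h0, by simp⟩
    rw [hsplit, hsplit 0 (ψ 0)] at this
    linarith
  have hint : ∀ v ∈ interior C, f (v, 0) + ψ v * f (0, 1) ≤ ψ 0 * f (0, 1) := fun v hv => by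
    refine le_of_forall_pos_lt_add fun ε hε => ?_
    have := hf (v, ψ v - ε / f (0, 1)) ⟨hv, by simpa using div_pos hε hb⟩
    rw [hsplit, hsplit 0 (ψ 0), sub_mul, div_mul_cancel₀ _ hb.ne'] at this
    have h00 : f ((0 : V), (0 : ℝ)) = 0 := map_zero f
    linarith
  refine ⟨-((f (0, 1))⁻¹ • f.comp (ContinuousLinearMap.inl ℝ V ℝ)), fun v hv => ?_⟩
  -- The bound is known only on the interior. For a general `v ∈ C`, apply it at the midpoint of `0`
  -- and `v`, then transfer it to `v` by concavity.
  have hhalf : (2⁻¹ : ℝ) • v ∈ interior C := by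
    have := hψ.1.combo_interior_self_mem_interior h0 hv (show (0 : ℝ) < 2⁻¹ by norm_num)
      (show (0 : ℝ) ≤ 2⁻¹ by norm_num) (by norm_num)
    simpa using this
  have h1 := hint _ hhalf
  have h2 := hψ.2 (interior_subset h0) hv (show (0 : ℝ) ≤ 2⁻¹ by norm_num)
    (show (0 : ℝ) ≤ 2⁻¹ by norm_num) (by norm_num)
  rw [smul_zero, zero_add, smul_eq_mul, smul_eq_mul] at h2
  have h3 : f ((2⁻¹ : ℝ) • v, 0) = 2⁻¹ * f (v, 0) := by
    have : (((2⁻¹ : ℝ) • v, 0) : V × ℝ) = (2⁻¹ : ℝ) • (v, 0) := by simp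
    rw [this, map_smul, smul_eq_mul]
  have h4 : f (v, 0) + ψ v * f (0, 1) ≤ ψ 0 * f (0, 1) := by
    have := mul_le_mul_of_nonneg_right h2 hb.le
    rw [h3] at h1
    linarith
  have h5 : ψ v ≤ ψ 0 - (f (0, 1))⁻¹ * f (v, 0) := by
    have := mul_le_mul_of_nonneg_left h4 (inv_nonneg.2 hb.le)
    field_simp at this ⊢
    linarith
  simpa [sub_eq_add_neg] using h5

variable {d : ℕ}

local notation "E" => EuclideanSpace ℝ (Fin d)

/-- A finite concave function on a nonempty convex subset of `ℝᵈ` has an affine majorant. -/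
theorem _root_.ConcaveOn.exists_affine_majorant {C : Set E} {φ : E → ℝ} (hφ : ConcaveOn ℝ C φ)
    (hC : C.Nonempty) : ∃ (α : E) (β : ℝ), ∀ z ∈ C, φ z ≤ ⟪α, z⟫ + β := by
  obtain ⟨x, hx⟩ := Set.Nonempty.intrinsicInterior hφ.1 hC
  obtain ⟨x', hx', rfl⟩ := mem_intrinsicInterior.1 hx
  -- `C` may have empty interior, so work in the direction of its affine span, centred at a relative
  -- interior point `x'`; the origin of `V` is then interior.
  let V := (affineSpan ℝ C).direction
  let T : V →ᵃ[ℝ] E := V.subtype.toAffineMap + AffineMap.const ℝ V (x' : E)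
  have hT : ∀ v : V, T v = (v : E) + x' := fun v => rfl
  have hψ : ConcaveOn ℝ (T ⁻¹' C) (φ ∘ T) := hφ.comp_affineMap T
  have h0 : (0 : V) ∈ interior (T ⁻¹' C) := by
    let S : V → affineSpan ℝ C := fun v =>
      ⟨(v : E) + x', AffineSubspace.vadd_mem_of_mem_direction v.2 x'.2⟩
    have hS : Continuous S := by fun_prop
    have hsub : S ⁻¹' interior ((↑) ⁻¹' C) ⊆ T ⁻¹' C := fun v hv =>
      interior_subset (s := ((↑) ⁻¹' C : Set (affineSpan ℝ C))) hv
    exact mem_interior.2 ⟨_, hsub, isOpen_interior.preimage hS, by simpa [S] using hx'⟩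
  obtain ⟨a, ha⟩ := hψ.exists_supergradient h0
  let α : V := (InnerProductSpace.toDual ℝ V).symm a
  refine ⟨α, φ x' - ⟪(α : E), (x' : E)⟫, fun z hz => ?_⟩
  have hzV : z - x' ∈ V := AffineSubspace.vsub_mem_direction (mem_affineSpan ℝ hz) x'.2
  have h := ha ⟨z - x', hzV⟩ (by simpa [hT] using hz)
  have h2 : a ⟨z - x', hzV⟩ = ⟪(α : E), z - x'⟫ := by
    rw [← InnerProductSpace.toDual_symm_apply]; rfl
  simp only [Function.comp, hT, sub_add_cancel, h2, inner_sub_right, ZeroMemClass.coe_zero,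
    zero_add] at h
  linarith

/-- If `x` is strictly separated from `K`, the affine majorants of `g` on `K` are unbounded below
at `x`. -/
theorem affineInf_eq_bot_of_separated {g : E → EReal} {K : Set E} {x γ : E} {s : ℝ}
    (hK : ∀ z ∈ K, ⟪γ, z⟫ ≤ s) (hx : s < ⟪γ, x⟫)
    (hmaj : ∃ (α : E) (β : ℝ), ∀ z ∈ K, g z ≤ ((⟪α, z⟫ + β : ℝ) : EReal)) :
    affineInf g K x = ⊥ := by
  obtain ⟨α, β, h⟩ := hmaj
  refine EReal.eq_bot_iff_forall_lt _ |>.2 fun t => ?_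
  -- Adding `n (s - ⟪γ, ·⟫)`, nonnegative on `K` and negative at `x`, keeps a majorant while
  -- lowering its value at `x` below `t`.
  obtain ⟨n, hn⟩ := exists_nat_gt ((⟪α, x⟫ + β - t) / (⟪γ, x⟫ - s))
  rw [div_lt_iff₀ (sub_pos.2 hx)] at hn
  refine lt_of_le_of_lt (sInf_le ⟨α - (n : ℝ) • γ, β + n * s, fun z hz => (h z hz).trans ?_, rfl⟩) ?_
  · rw [EReal.coe_le_coe_iff, inner_sub_left, real_inner_smul_left]
    have := mul_le_mul_of_nonneg_left (hK z hz) (Nat.cast_nonneg (α := ℝ) n)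
    linarith
  · rw [EReal.coe_lt_coe_iff, inner_sub_left, real_inner_smul_left]
    linarith

theorem affineInf_eq_bot {g : E → EReal} {K : Set E} {x : E}
    (hx : x ∉ closure (convexHull ℝ K))
    (hmaj : ∃ (α : E) (β : ℝ), ∀ z ∈ K, g z ≤ ((⟪α, z⟫ + β : ℝ) : EReal)) :
    affineInf g K x = ⊥ := by
  obtain ⟨f, s, hf, hs⟩ := geometric_hahn_banach_closed_point (convex_convexHull ℝ K).closure
    isClosed_closure hx
  refine affineInf_eq_bot_of_separated (γ := (InnerProductSpace.toDual ℝ E).symm f) (s := s)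
    (fun z hz => ?_) ?_ hmaj
  · rw [InnerProductSpace.toDual_symm_apply]
    exact (hf z (subset_closure (subset_convexHull ℝ K hz))).le
  · rwa [InnerProductSpace.toDual_symm_apply]

theorem isConcave_affine (α : E) (β : ℝ) :
    IsConcave fun z : E => ((⟪α, z⟫ + β : ℝ) : EReal) := by
  have : ConcaveOn ℝ Set.univ fun z : E => ⟪α, z⟫ + β :=
    ((innerSL ℝ α).toLinearMap.concaveOn convex_univ).add_const β
  simpa only [IsConcave, EReal.coe_le_coe_iff, Set.mem_univ, true_and] using this.convex_hypograph

theorem uscHull_relConc_le_affineInf (g : E → EReal) (K : Set E) (x : E) :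
    uscHull (relConc g K) x ≤ affineInf g K x := by
  refine le_sInf ?_
  rintro _ ⟨α, β, h, rfl⟩
  have hle : ∀ u, relConc g K u ≤ ((⟪α, u⟫ + β : ℝ) : EReal) := fun u =>
    sInf_le ⟨_, isConcave_affine α β, h, rfl⟩
  have hc : Continuous fun u : E => ((⟪α, u⟫ + β : ℝ) : EReal) :=
    continuous_coe_real_ereal.comp (by fun_prop)
  calc uscHull (relConc g K) x ≤ limsup (fun u : E => ((⟪α, u⟫ + β : ℝ) : EReal)) (𝓝 x) :=
        limsup_le_limsup (Eventually.of_forall hle)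
    _ = _ := (hc.tendsto x).limsup_eq

theorem le_relConc_of_mem_convexHull {g : E → EReal} {K : Set E} {p : E × ℝ}
    (hp : p ∈ convexHull ℝ {p : E × ℝ | p.1 ∈ K ∧ (p.2 : EReal) ≤ g p.1}) :
    (p.2 : EReal) ≤ relConc g K p.1 := by
  refine le_sInf ?_
  rintro _ ⟨v, hv, hgv, rfl⟩
  exact convexHull_min (fun q hq => hq.2.trans (hgv _ hq.1)) hv hp

/-- The upper closure of the concave envelope is the infimum of the affine majorants. -/
theorem uscHull_relConc_eq_affineInf {g : E → EReal} {K : Set E} (hK : K.Nonempty) (hg : ∀ z ∈ K, ⊥ < g z)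
    (hmaj : ∃ (α : E) (β : ℝ), ∀ z ∈ K, g z ≤ ((⟪α, z⟫ + β : ℝ) : EReal)) (x : E) :
    uscHull (relConc g K) x = affineInf g K x := by
  refine (uscHull_relConc_le_affineInf g K x).antisymm (le_of_not_gt fun hlt => ?_)
  obtain ⟨t, ht1, ht2⟩ := EReal.lt_iff_exists_real_btwn.1 hlt
  obtain ⟨t', ht'1, ht'2⟩ := EReal.lt_iff_exists_real_btwn.1 ht1
  set C := convexHull ℝ {p : E × ℝ | p.1 ∈ K ∧ (p.2 : EReal) ≤ g p.1} with hC
  -- The concave envelope stays below `t' < t` near `x`, whereas it dominates the height of every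
  -- point of `C`.
  have hxt : (x, t) ∉ closure C := fun hmem => by
    have h1 : ∀ᶠ u in 𝓝 x, relConc g K u < t' := eventually_lt_of_limsup_lt ht'1
    have h2 : ∀ᶠ p : E × ℝ in 𝓝 (x, t), relConc g K p.1 < t' ∧ t' < p.2 :=
      (continuous_fst.tendsto (x, t)).eventually h1 |>.and
        ((continuous_snd.tendsto (x, t)).eventually
          (lt_mem_nhds (EReal.coe_lt_coe_iff.1 ht'2)))
    obtain ⟨p, hpC, hp⟩ := ((mem_closure_iff_frequently.1 hmem).and_eventually h2).exists
    have := (le_relConc_of_mem_convexHull hpC).trans_lt hp.1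
    exact absurd (EReal.coe_lt_coe_iff.1 this) (not_lt.2 hp.2.le)
  obtain ⟨f, s, hf, hs⟩ := geometric_hahn_banach_closed_point
    (convex_convexHull ℝ _).closure isClosed_closure hxt
  have hsplit : ∀ v r, f (v, r) = f (v, 0) + r * f (0, 1) := fun v r => by
    have : ((v, r) : E × ℝ) = (v, 0) + r • (0, 1) := by simp
    rw [this, map_add, map_smul, smul_eq_mul]
  set b := f (0, 1) with hb
  set γ : E := (InnerProductSpace.toDual ℝ E).symm (f.comp (ContinuousLinearMap.inl ℝ E ℝ)) with hγ
  have hγf : ∀ v, f (v, 0) = ⟪γ, v⟫ := fun v => by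
    rw [hγ, InnerProductSpace.toDual_symm_apply]; rfl
  have hfK : ∀ z ∈ K, ∀ r : ℝ, (r : EReal) ≤ g z → ⟪γ, z⟫ + r * b < s := fun z hz r hr => by
    rw [← hγf, ← hsplit]
    exact hf _ (subset_closure (subset_convexHull ℝ _ ⟨hz, hr⟩))
  rw [hsplit, hγf] at hs
  obtain ⟨z₀, hz₀⟩ := hK
  obtain ⟨r₀, -, hr₀⟩ := EReal.lt_iff_exists_real_btwn.1 (hg z₀ hz₀)
  -- The hypograph is unbounded downwards, which rules out `b < 0`.
  have hb0 : 0 ≤ b := by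
    by_contra! hneg
    obtain ⟨n, hn⟩ := exists_nat_gt ((s - ⟪γ, z₀⟫ - r₀ * b) / (-b))
    rw [div_lt_iff₀ (neg_pos.2 hneg)] at hn
    have := hfK z₀ hz₀ (r₀ - n) (le_trans (EReal.coe_le_coe_iff.2
      (sub_le_self _ (Nat.cast_nonneg n))) hr₀.le)
    linarith
  -- A vertical hyperplane (`b = 0`) strictly separates `x` from `K` and forces the value `⊥`.
  -- Otherwise solving for the height gives an affine majorant lying below `t` at `x`.
  rcases hb0.eq_or_lt with hb0 | hb0
  · have hbot : affineInf g K x = ⊥ := by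
      refine affineInf_eq_bot_of_separated (γ := γ) (s := s) (fun z hz => ?_)
        (by simpa [← hb0] using hs) hmaj
      obtain ⟨r, -, hr⟩ := EReal.lt_iff_exists_real_btwn.1 (hg z hz)
      simpa [← hb0] using (hfK z hz r hr.le).le
    rw [hbot] at ht2
    exact not_lt_bot ht2
  · have hle : affineInf g K x ≤ ((⟪-b⁻¹ • γ, x⟫ + b⁻¹ * s : ℝ) : EReal) := by
      refine sInf_le ⟨_, _, fun z hz => ?_, rfl⟩
      refine EReal.ge_of_forall_gt_iff_ge.1 fun c hc => ?_
      rw [EReal.coe_le_coe_iff, real_inner_smul_left]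
      have h2 := mul_lt_mul_of_pos_left (hfK z hz c hc.le) (inv_pos.2 hb0)
      have h3 : b⁻¹ * (⟪γ, z⟫ + c * b) = b⁻¹ * ⟪γ, z⟫ + c := by field_simp
      linarith
    have := ht2.trans_le hle
    rw [EReal.coe_lt_coe_iff, real_inner_smul_left] at this
    have h2 := mul_lt_mul_of_pos_left hs (inv_pos.2 hb0)
    have h3 : b⁻¹ * (⟪γ, x⟫ + t * b) = b⁻¹ * ⟪γ, x⟫ + t := by field_simp
    linarith

end ConvexAnalysis

/-! ### Conjugates and affine majorants via `tiltedSup` -/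

section Duality

variable {d : ℕ}

local notation "E" => EuclideanSpace ℝ (Fin d)

/-- The least intercept of an affine majorant of `g` on `K` with slope `θ`. -/
def tiltedSup (g : E → EReal) (K : Set E) (θ : E) : EReal :=
  ⨆ z ∈ K, g z - ((⟪θ, z⟫ : ℝ) : EReal)

theorem tiltedSup_le_coe_iff {g : E → EReal} {K : Set E} {θ : E} {β : ℝ} :
    tiltedSup g K θ ≤ β ↔ ∀ z ∈ K, g z ≤ ((⟪θ, z⟫ + β : ℝ) : EReal) := by
  simp only [tiltedSup, iSup_le_iff]
  refine forall₂_congr fun z _ => ?_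
  rw [EReal.sub_le_iff_le_add (.inl (EReal.coe_ne_bot _)) (.inl (EReal.coe_ne_top _)), add_comm,
    EReal.coe_add]

theorem bot_lt_tiltedSup {g : E → EReal} {K : Set E} (hK : K.Nonempty) (hg : ∀ z ∈ K, ⊥ < g z)
    (θ : E) : ⊥ < tiltedSup g K θ := by
  obtain ⟨z, hz⟩ := hK
  refine lt_of_lt_of_le ?_ (le_iSup₂ (f := fun z _ => g z - ((⟪θ, z⟫ : ℝ) : EReal)) z hz)
  have := hg z hz
  rw [sub_eq_add_neg, ← EReal.coe_neg]
  exact EReal.bot_lt_add_iff.2 ⟨this, EReal.bot_lt_coe _⟩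

theorem conjugate_negOn_neg (g : E → EReal) (K : Set E) (θ : E) :
    conjugate (negOn g K) (-θ) = tiltedSup g K θ := by
  refine iSup_congr fun z => ?_
  by_cases hz : z ∈ K
  · rw [negOn, if_pos hz, iSup_pos hz, sub_eq_add_neg, neg_neg, add_comm, inner_neg_left,
      EReal.coe_neg, ← sub_eq_add_neg]
  · rw [negOn, if_neg hz, iSup_neg hz, EReal.sub_top]

theorem affineInf_eq_iInf {g : E → EReal} {K : Set E} (hK : K.Nonempty) (hg : ∀ z ∈ K, ⊥ < g z)
    (x : E) : affineInf g K x = ⨅ θ, tiltedSup g K θ + ((⟪θ, x⟫ : ℝ) : EReal) := by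
  refine le_antisymm (le_iInf fun θ => ?_) (le_sInf ?_)
  · have hbot := bot_lt_tiltedSup hK hg θ
    induction h : tiltedSup g K θ with
    | bot => exact absurd h hbot.ne'
    | top => rw [EReal.top_add_coe]; exact le_top
    | coe β =>
      refine sInf_le ⟨θ, β, tiltedSup_le_coe_iff.1 h.le, ?_⟩
      rw [add_comm, EReal.coe_add]
  · rintro _ ⟨α, β, h, rfl⟩
    refine iInf_le_of_le α ?_
    rw [add_comm, EReal.coe_add]
    gcongr
    exact tiltedSup_le_coe_iff.2 h

theorem neg_biconjugate_negOn (g : E → EReal) (K : Set E) (x : E) :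
    -conjugate (conjugate (negOn g K)) x =
      ⨅ θ, tiltedSup g K θ + ((⟪θ, x⟫ : ℝ) : EReal) := by
  have h : ∀ f : E → EReal, -(⨆ z, f z) = ⨅ z, -f z := fun f =>
    EReal.negOrderIso.map_iSup f
  rw [conjugate, h, ← (Equiv.neg E).iInf_comp]
  refine iInf_congr fun θ => ?_
  rw [Equiv.neg_apply, conjugate_negOn_neg, inner_neg_right,
    EReal.neg_sub (.inl (EReal.coe_ne_bot _)) (.inl (EReal.coe_ne_top _)), EReal.coe_neg, neg_neg,
    add_comm, real_inner_comm]

/-- If `K` lies in the nonnegative orthant, then `tiltedSup g K` is antitone, and the slopes may be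
restricted to a dense sequence. -/
theorem iInf_tiltedSup_eq_iInf_denseSeq {g : E → EReal} {K : Set E} (hK0 : ∀ z ∈ K, ∀ i, 0 ≤ z i)
    (x : E) : ⨅ θ, tiltedSup g K θ + ((⟪θ, x⟫ : ℝ) : EReal) =
      ⨅ n, tiltedSup g K (TopologicalSpace.denseSeq E n) +
        ((⟪TopologicalSpace.denseSeq E n, x⟫ : ℝ) : EReal) := by
  refine le_antisymm (le_iInf fun n => iInf_le _ _) (le_iInf fun θ => ?_)
  refine EReal.le_of_forall_lt_iff_le.1 fun c hc => ?_
  have hc' : tiltedSup g K θ < ((c - ⟪θ, x⟫ : ℝ) : EReal) := by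
    rw [EReal.coe_sub]
    exact EReal.lt_sub_iff_add_lt (.inl (EReal.coe_ne_bot _)) (.inl (EReal.coe_ne_top _)) |>.2 hc
  obtain ⟨b, hb1, hb2⟩ := EReal.lt_iff_exists_real_btwn.1 hc'
  have hb2 : b < c - ⟪θ, x⟫ := EReal.coe_lt_coe_iff.1 hb2
  -- Slopes strictly above `θ` in each coordinate do not increase `tiltedSup`; the second condition
  -- keeps the total below `c`. `U` is open, and it is nonempty by a small shift of `θ` along the
  -- all-ones vector.
  let U : Set E := {η | (∀ i, θ i < η i) ∧ ⟪η, x⟫ < c - b}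
  have hU : IsOpen U := by
    have h1 : IsOpen {η : E | ∀ i, θ i < η i} := by
      rw [Set.ofPred_forall]
      exact isOpen_iInter_of_finite fun i =>
        isOpen_lt continuous_const (EuclideanSpace.proj (𝕜 := ℝ) i).continuous
    have h2 : IsOpen {η : E | ⟪η, x⟫ < c - b} := isOpen_lt (by fun_prop) continuous_const
    exact h1.inter h2
  have hUne : U.Nonempty := by
    let e : E := WithLp.toLp 2 fun _ => 1
    have hlim : Tendsto (fun t : ℝ => ⟪θ + t • e, x⟫) (𝓝[>] 0) (𝓝 ⟪θ, x⟫) := by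
      have : Continuous fun t : ℝ => ⟪θ + t • e, x⟫ := by fun_prop
      simpa using (this.tendsto 0).mono_left nhdsWithin_le_nhds
    obtain ⟨t, ht, ht0⟩ := ((hlim.eventually_lt_const (show ⟪θ, x⟫ < c - b by linarith)).and
      self_mem_nhdsWithin).exists
    exact ⟨θ + t • e, fun i => by simpa [e] using ht0, ht⟩
  obtain ⟨n, hn1, hn2⟩ := (TopologicalSpace.denseRange_denseSeq E).exists_mem_open hU hUne
  refine iInf_le_of_le n ?_
  have hle : tiltedSup g K (TopologicalSpace.denseSeq E n) ≤ (b : EReal) := by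
    rw [tiltedSup_le_coe_iff]
    intro z hz
    refine (tiltedSup_le_coe_iff.1 hb1.le z hz).trans (EReal.coe_le_coe_iff.2 ?_)
    gcongr
    simp only [PiLp.inner_apply, RCLike.inner_apply, conj_trivial]
    exact Finset.sum_le_sum fun i _ => mul_le_mul_of_nonneg_left (hn1 i).le (hK0 z hz i)
  calc _ ≤ (b : EReal) + ((c - b : ℝ) : EReal) := by
        gcongr
    _ = c := by rw [← EReal.coe_add]; congr 1; ring

end Duality

/-! ### Semicontinuity and joint measurability of normal integrands -/

section Integrand

variable {Ω : Type*} {d : ℕ}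

local notation "E" => EuclideanSpace ℝ (Fin d)

/-- The condition says that `(z, ⟪θ, z⟫ + r)` lies strictly below the graph for some real `r ≥ a`,
so the set is a union of preimages of the open complement of the epigraph. -/
theorem IsNormalIntegrand.isOpen_lt {H : MeasurableSpace Ω} {g : Ω → E → EReal}
    (hg : IsNormalIntegrand H g) (ω : Ω) (θ : E) (a : EReal) :
    IsOpen {z | a < g ω z - ((⟪θ, z⟫ : ℝ) : EReal)} := by
  have : {z | a < g ω z - ((⟪θ, z⟫ : ℝ) : EReal)} =
      ⋃ r ∈ {r : ℝ | a ≤ r}, (fun z => (z, ⟪θ, z⟫ + r)) ⁻¹' {p : E × ℝ | g ω p.1 ≤ (p.2 : EReal)}ᶜ := by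
    ext z
    simp only [Set.mem_ofPred_eq, Set.mem_iUnion, Set.mem_preimage, Set.mem_compl_iff, not_le,
      exists_prop]
    have key : ∀ r : ℝ, ((⟪θ, z⟫ + r : ℝ) : EReal) < g ω z ↔
        (r : EReal) < g ω z - ((⟪θ, z⟫ : ℝ) : EReal) := fun r => by
      rw [EReal.lt_sub_iff_add_lt (.inl (EReal.coe_ne_bot _)) (.inl (EReal.coe_ne_top _)),
        add_comm, EReal.coe_add]
    simp only [key]
    refine ⟨fun h => ?_, fun ⟨r, h1, h2⟩ => h1.trans_lt h2⟩
    obtain ⟨r, hr1, hr2⟩ := EReal.lt_iff_exists_real_btwn.1 h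
    exact ⟨r, hr1.le, hr2⟩
  rw [this]
  exact isOpen_biUnion fun r _ => (hg.closed_epi ω).isOpen_compl.preimage (by fun_prop)

theorem IsNormalIntegrand.isOpen_coe_lt {H : MeasurableSpace Ω} {g : Ω → E → EReal}
    (hg : IsNormalIntegrand H g) (ω : Ω) (r : ℝ) : IsOpen {z | (r : EReal) < g ω z} := by
  simpa using hg.isOpen_lt ω 0 r

/-- A normal integrand is jointly measurable. -/
theorem IsNormalIntegrand.measurable_uncurry {H : MeasurableSpace Ω} {g : Ω → E → EReal}
    (hg : IsNormalIntegrand H g) : Measurable fun p : Ω × E => g p.1 p.2 := by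
  refine measurable_of_Ioi fun a => ?_
  have hcount := TopologicalSpace.countable_countableBasis E
  -- By lower semicontinuity, `g ω z > a` iff for some rational `q > a` and some basic open `B`
  -- containing `z` the epigraph misses `B × (-∞, q)`: a countable union of measurable rectangles.
  have : (fun p : Ω × E => g p.1 p.2) ⁻¹' Set.Ioi a =
      ⋃ q ∈ {q : ℚ | a < ((q : ℝ) : EReal)}, ⋃ B ∈ TopologicalSpace.countableBasis E,
        {ω | ∃ p ∈ B ×ˢ Set.Iio (q : ℝ), g ω p.1 ≤ (p.2 : EReal)}ᶜ ×ˢ B := by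
    ext ⟨ω, z⟩
    simp only [Set.mem_preimage, Set.mem_Ioi, Set.mem_iUnion, Set.mem_ofPred_eq, Set.mem_prod,
      Set.mem_compl_iff, exists_prop, Set.mem_Iio, not_exists, not_and, not_le, Prod.forall]
    constructor
    · intro h
      obtain ⟨q, hq1, hq2⟩ := EReal.lt_iff_exists_rat_btwn.1 h
      obtain ⟨B, hB, hzB, hBsub⟩ := (TopologicalSpace.isBasis_countableBasis E).exists_subset_of_mem_open
        hq2 (hg.isOpen_coe_lt ω q)
      exact ⟨q, hq1, B, hB, fun w r hw => lt_trans (EReal.coe_lt_coe_iff.2 hw.2) (hBsub hw.1), hzB⟩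
    · rintro ⟨q, hq, B, hB, h, hzB⟩
      refine hq.trans_le (EReal.ge_of_forall_gt_iff_ge.1 fun c hc => ?_)
      exact (h z c ⟨hzB, EReal.coe_lt_coe_iff.1 hc⟩).le
  rw [this]
  refine MeasurableSet.biUnion (Set.to_countable _) fun q _ => MeasurableSet.biUnion hcount
    fun B hB => ?_
  have hBo := TopologicalSpace.isOpen_of_mem_countableBasis hB
  exact (hg.measurable_epi _ (hBo.prod isOpen_Iio)).compl.prod hBo.measurableSet

end Integrand

/-! ### Conditional support and conditional essential suprema -/

section ConditionalSupport

variable {d : ℕ}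

local notation "E" => EuclideanSpace ℝ (Fin d)

theorem lawSupport_eq_support (μ : Measure E) [IsProbabilityMeasure μ] :
    lawSupport μ = μ.support := by
  rw [Measure.support_eq_sInter, lawSupport]
  congr 1
  ext A
  simp only [Set.mem_ofPred_eq]
  exact and_congr_right fun hA => (prob_compl_eq_zero_iff hA.measurableSet).symm

theorem lawSupport_nonempty (μ : Measure E) [IsProbabilityMeasure μ] : (lawSupport μ).Nonempty := by
  rw [lawSupport_eq_support]
  exact Measure.nonempty_support (IsProbabilityMeasure.ne_zero μ)

/-- This replaces suprema of lower semicontinuous functions over the support by measures of open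
sets, which depend measurably on `ω`. -/
theorem exists_mem_lawSupport_iff (μ : Measure E) [IsProbabilityMeasure μ] {U : Set E}
    (hU : IsOpen U) : (∃ z ∈ lawSupport μ, z ∈ U) ↔ μ U ≠ 0 := by
  rw [lawSupport_eq_support]
  refine ⟨fun ⟨z, hz, hzU⟩ =>
    ((Measure.mem_support_iff_forall z).1 hz U (hU.mem_nhds hzU)).ne', fun h => ?_⟩
  obtain ⟨z, hzU, hz⟩ := Measure.nonempty_inter_support_of_pos (pos_iff_ne_zero.2 h)
  exact ⟨z, hz, hzU⟩

theorem forall_mem_lawSupport_of_ae {μ : Measure E} [IsProbabilityMeasure μ] {A : Set E}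
    (hA : IsClosed A) (h : ∀ᵐ z ∂μ, z ∈ A) : ∀ z ∈ lawSupport μ, z ∈ A := fun z hz => by
  by_contra hzA
  exact (exists_mem_lawSupport_iff μ hA.isOpen_compl).1 ⟨z, hz, hzA⟩ h

section Kernel

variable {Ω : Type*} {mΩ : MeasurableSpace Ω} {κ : Kernel Ω (EuclideanSpace ℝ (Fin d))}
  [IsMarkovKernel κ]

theorem measurableSet_mem_lawSupport :
    MeasurableSet {p : Ω × E | p.2 ∈ lawSupport (κ p.1)} := by
  have hcount := TopologicalSpace.countable_countableBasis E
  have : {p : Ω × E | p.2 ∈ lawSupport (κ p.1)}ᶜ =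
      ⋃ B ∈ TopologicalSpace.countableBasis E, {ω | κ ω B = 0} ×ˢ B := by
    ext ⟨ω, z⟩
    simp only [Set.mem_compl_iff, Set.mem_ofPred_eq, Set.mem_iUnion, Set.mem_prod, exists_prop,
      lawSupport_eq_support]
    rw [(TopologicalSpace.isBasis_countableBasis E).nhds_hasBasis.notMem_measureSupport]
    exact ⟨fun ⟨B, hB, h⟩ => ⟨B, hB.1, h, hB.2⟩, fun ⟨B, hB, h, hz⟩ => ⟨B, ⟨hB, hz⟩, h⟩⟩
  refine MeasurableSet.of_compl (this ▸ MeasurableSet.biUnion hcount fun B hB => ?_)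
  have hBm := (TopologicalSpace.isOpen_of_mem_countableBasis hB).measurableSet
  exact (κ.measurable_coe hBm (measurableSet_singleton 0)).prod hBm

theorem IsNormalIntegrand.measurable_uncurry_sub {g : Ω → E → EReal} (hg : IsNormalIntegrand mΩ g)
    {θ : Ω → E} (hθ : Measurable θ) :
    Measurable fun p : Ω × E => g p.1 p.2 - ((⟪θ p.1, p.2⟫ : ℝ) : EReal) := by
  have h : Measurable fun p : Ω × E => ⟪θ p.1, p.2⟫ := by fun_prop
  simp only [sub_eq_add_neg, ← EReal.coe_neg]
  exact hg.measurable_uncurry.add h.neg.coe_real_ereal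

theorem IsNormalIntegrand.measurableSet_sub_le {g : Ω → E → EReal} (hg : IsNormalIntegrand mΩ g)
    {θ : Ω → E} (hθ : Measurable θ) {ζ : Ω → EReal} (hζ : Measurable ζ) :
    MeasurableSet {p : Ω × E | g p.1 p.2 - ((⟪θ p.1, p.2⟫ : ℝ) : EReal) ≤ ζ p.1} :=
  measurableSet_le (hg.measurable_uncurry_sub hθ) (hζ.comp measurable_fst)

/-- The supremum exceeds `a` iff the open section where the integrand exceeds `a` has positive `κ
ω`-measure, so no measurable selection from the support is needed. -/
theorem IsNormalIntegrand.measurable_tiltedSup {g : Ω → E → EReal} (hg : IsNormalIntegrand mΩ g)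
    {θ : Ω → E} (hθ : Measurable θ) :
    Measurable fun ω => tiltedSup (g ω) (lawSupport (κ ω)) (θ ω) := by
  refine measurable_of_Ioi fun a => ?_
  have hset : MeasurableSet {p : Ω × E | a < g p.1 p.2 - ((⟪θ p.1, p.2⟫ : ℝ) : EReal)} :=
    hg.measurable_uncurry_sub hθ measurableSet_Ioi
  have : (fun ω => tiltedSup (g ω) (lawSupport (κ ω)) (θ ω)) ⁻¹' Set.Ioi a =
      {ω | κ ω (Prod.mk ω ⁻¹' {p : Ω × E | a < g p.1 p.2 - ((⟪θ p.1, p.2⟫ : ℝ) : EReal)}) = 0}ᶜ := by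
    ext ω
    simp only [tiltedSup, Set.mem_preimage, Set.mem_Ioi, lt_iSup_iff, exists_prop]
    exact exists_mem_lawSupport_iff (κ ω) (hg.isOpen_lt ω (θ ω) a)
  rw [this]
  exact (Kernel.measurable_kernel_prodMk_left hset (measurableSet_singleton 0)).compl

end Kernel

/-! ### Disintegration of the joint law -/

section Disintegration

variable {Ω Ω' : Type*} {mΩ : MeasurableSpace Ω} {mΩ' : MeasurableSpace Ω'} {P : Measure Ω}
  [IsProbabilityMeasure P] {X : Ω → Ω'} {Y : Ω → EuclideanSpace ℝ (Fin d)}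
  {κ : Kernel Ω' (EuclideanSpace ℝ (Fin d))} [IsMarkovKernel κ]

/-- A regular version of the conditional law of `Y` given `X` disintegrates the joint law. -/
theorem map_compProd_eq_map_prodMk (hX : Measurable X) (hY : Measurable Y)
    (hκ : ∀ A : Set E, MeasurableSet A →
      (fun ω => (κ (X ω)).real A) =ᵐ[P] P⟦Y ⁻¹' A | mΩ'.comap X⟧) :
    (P.map X) ⊗ₘ κ = P.map fun ω => (X ω, Y ω) := by
  have : IsProbabilityMeasure (P.map X) := Measure.isProbabilityMeasure_map hX.aemeasurable
  -- On a rectangle the identity is the defining property of the conditional expectation of the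
  -- indicator of `Y ⁻¹' t`.
  refine Measure.ext_prod fun {s t} hs ht => ?_
  rw [Measure.compProd_apply_prod hs ht, Measure.map_apply (hX.prodMk hY) (hs.prod ht),
    setLIntegral_map hs (κ.measurable_coe ht) hX, Set.mk_preimage_prod]
  have hlt : ∫⁻ ω in X ⁻¹' s, κ (X ω) t ∂P < ⊤ :=
    (lintegral_mono fun ω => prob_le_one).trans_lt (by simp [measure_lt_top])
  rw [← ENNReal.toReal_eq_toReal_iff' hlt.ne (measure_ne_top _ _),
    ← integral_toReal (f := fun ω => κ (X ω) t) ((κ.measurable_coe ht).comp hX).aemeasurable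
      (Eventually.of_forall fun ω => measure_lt_top _ _)]
  calc ∫ ω in X ⁻¹' s, (κ (X ω)).real t ∂P
      = ∫ ω in X ⁻¹' s, (P⟦Y ⁻¹' t | mΩ'.comap X⟧) ω ∂P :=
        integral_congr_ae (ae_restrict_of_ae (hκ t ht))
    _ = ∫ ω in X ⁻¹' s, (Y ⁻¹' t).indicator (fun _ => (1 : ℝ)) ω ∂P :=
        setIntegral_condExp hX.comap_le ((integrable_const 1).indicator (hY ht)) ⟨s, hs, rfl⟩
    _ = P.real (X ⁻¹' s ∩ Y ⁻¹' t) := by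
        rw [setIntegral_indicator (hY ht)]
        simp

theorem ae_prodMk_mem_iff (hX : Measurable X) (hY : Measurable Y)
    (hκ : ∀ A : Set E, MeasurableSet A →
      (fun ω => (κ (X ω)).real A) =ᵐ[P] P⟦Y ⁻¹' A | mΩ'.comap X⟧)
    {B : Set (Ω' × E)} (hB : MeasurableSet B) :
    (∀ᵐ ω ∂P, (X ω, Y ω) ∈ B) ↔ ∀ᵐ ω ∂P, ∀ᵐ z ∂κ (X ω), (X ω, z) ∈ B := by
  have : IsProbabilityMeasure (P.map X) := Measure.isProbabilityMeasure_map hX.aemeasurable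
  have hset : MeasurableSet {x | ∀ᵐ z ∂κ x, (x, z) ∈ B} :=
    Kernel.measurable_kernel_prodMk_left hB.compl (measurableSet_singleton 0)
  rw [← ae_map_iff (p := (· ∈ B)) (hX.prodMk hY).aemeasurable hB,
    ← map_compProd_eq_map_prodMk hX hY hκ, Measure.ae_compProd_iff (p := (· ∈ B)) hB,
    ae_map_iff hX.aemeasurable hset]

end Disintegration

section RegularCondLaw

variable {Ω : Type*} {H : MeasurableSpace Ω} [m₀ : MeasurableSpace Ω] {P : Measure Ω}
  [IsProbabilityMeasure P] {Y : Ω → EuclideanSpace ℝ (Fin d)}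
  {κ : Kernel[H] Ω (EuclideanSpace ℝ (Fin d))}

theorem IsRegularCondLaw.ae_mem_iff (hκ : IsRegularCondLaw H P Y κ) (hH : H ≤ m₀)
    (hY : Measurable Y) {B : Set (Ω × E)} (hB : MeasurableSet[H.prod inferInstance] B) :
    (∀ᵐ ω ∂P, (ω, Y ω) ∈ B) ↔ ∀ᵐ ω ∂P, ∀ᵐ z ∂κ ω, (ω, z) ∈ B := by
  have := hκ.1
  -- Conditioning on `H` is conditioning on the identity map from `(Ω, m₀)` to `(Ω, H)`.
  refine ae_prodMk_mem_iff (mΩ' := H) (X := id) (measurable_id'' hH) hY (fun A hA => ?_) hB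
  rw [MeasurableSpace.comap_id]
  exact hκ.2 A hA

theorem IsRegularCondLaw.ae_mem_lawSupport (hκ : IsRegularCondLaw H P Y κ) (hH : H ≤ m₀)
    (hY : Measurable Y) : ∀ᵐ ω ∂P, Y ω ∈ lawSupport (κ ω) := by
  have := hκ.1
  refine (hκ.ae_mem_iff hH hY (measurableSet_mem_lawSupport (mΩ := H) (κ := κ))).2
    (Eventually.of_forall fun ω => ?_)
  simp only [Set.mem_ofPred_eq, lawSupport_eq_support]
  exact Measure.support_mem_ae

theorem IsRegularCondLaw.ae_forall_mem_of_isClosed (hκ : IsRegularCondLaw H P Y κ) (hH : H ≤ m₀)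
    (hY : Measurable Y) {A : Set E} (hA : IsClosed A) (h : ∀ᵐ ω ∂P, Y ω ∈ A) :
    ∀ᵐ ω ∂P, ∀ z ∈ lawSupport (κ ω), z ∈ A := by
  have := hκ.1
  have hB : MeasurableSet[H.prod inferInstance] {p : Ω × E | p.2 ∈ A} :=
    @measurable_snd Ω E H _ A hA.measurableSet
  filter_upwards [(hκ.ae_mem_iff hH hY hB).1 h] with ω hω
  exact forall_mem_lawSupport_of_ae hA hω

/-- The conditional essential supremum of a normal integrand at `Y` is its supremum over the
conditional support of `Y`. -/
theorem IsRegularCondLaw.hedgeEssSup_ae_eq (hκ : IsRegularCondLaw H P Y κ) (hH : H ≤ m₀)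
    (hY : Measurable Y) {g : Ω → E → EReal} (hg : IsNormalIntegrand H g) {Z : Ω → ℝ}
    (hgZ : ∀ᵐ ω ∂P, g ω (Y ω) = (Z ω : EReal)) {θ : Ω → E} (hθ : Measurable[H] θ) :
    ∀ᵐ ω ∂P, hedgeEssSup H P Y Z θ ω = tiltedSup (g ω) (lawSupport (κ ω)) (θ ω) := by
  have := hκ.1
  refine (isCondEssSup_condEssSup hH P _).ae_eq
    ⟨hg.measurable_tiltedSup (mΩ := H) (κ := κ) hθ, ?_, fun ζ hζ h => ?_⟩
  · rintro _ rfl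
    filter_upwards [hκ.ae_mem_lawSupport hH hY, hgZ] with ω hω hω'
    refine le_trans (le_of_eq ?_) (le_iSup₂ (f := fun z _ => g ω z - ((⟪θ ω, z⟫ : ℝ) : EReal)) _ hω)
    rw [hω', EReal.coe_sub]
  · have hB : MeasurableSet[H.prod inferInstance]
        {p : Ω × E | g p.1 p.2 - ((⟪θ p.1, p.2⟫ : ℝ) : EReal) ≤ ζ p.1} :=
      hg.measurableSet_sub_le (mΩ := H) hθ hζ
    have hZζ : ∀ᵐ ω ∂P, g ω (Y ω) - ((⟪θ ω, Y ω⟫ : ℝ) : EReal) ≤ ζ ω := by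
      filter_upwards [h _ rfl, hgZ] with ω hω hω'
      rwa [hω', ← EReal.coe_sub]
    -- Minimality: the sublevel set of the integrand at `ζ ω` is closed and of full `κ ω`-measure,
    -- hence contains the support.
    filter_upwards [(hκ.ae_mem_iff hH hY hB).1 hZζ] with ω hω
    refine iSup₂_le fun z hz => ?_
    refine forall_mem_lawSupport_of_ae
      (A := {z | g ω z - ((⟪θ ω, z⟫ : ℝ) : EReal) ≤ ζ ω}) ?_ hω z hz
    simpa [Set.compl_ofPred] using (hg.isOpen_lt ω (θ ω) (ζ ω)).isClosed_compl

end RegularCondLaw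

end ConditionalSupport

/-! ### Super-hedging prices and the infimum cost -/

section Pricing

/-- One can measurably select an index at which `F` is finite, equal to `m` wherever `F m` is
finite. -/
theorem exists_measurable_index {Ω : Type*} [MeasurableSpace Ω] {F : ℕ → Ω → EReal}
    (hF : ∀ n, Measurable (F n)) (m : ℕ) : ∃ N : Ω → ℕ, Measurable N ∧
      Measurable (fun ω => F (N ω) ω) ∧
      ∀ ω, (∃ n, F n ω < ⊤) → F (N ω) ω < ⊤ ∧ (F m ω < ⊤ → N ω = m) := by
  classical
  -- If `F m` is finite, only `n = m` qualifies. The last alternative makes every index admissible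
  -- where no `F k` is finite, so that `Nat.find` is defined everywhere.
  let p : Ω → ℕ → Prop := fun ω n =>
    (F m ω < ⊤ ∧ n = m) ∨ (¬ F m ω < ⊤ ∧ F n ω < ⊤) ∨ ∀ k, ¬ F k ω < ⊤
  have hp : ∀ ω, ∃ n, p ω n := fun ω => by
    by_cases h : F m ω < ⊤
    · exact ⟨m, .inl ⟨h, rfl⟩⟩
    · by_cases h' : ∃ n, F n ω < ⊤
      · exact h'.imp fun n hn => .inr (.inl ⟨h, hn⟩)
      · exact ⟨0, .inr (.inr (not_exists.1 h'))⟩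
  have hlt : ∀ n, MeasurableSet {ω | F n ω < ⊤} := fun n => hF n measurableSet_Iio
  have htop : MeasurableSet {ω | ∀ k, ¬ F k ω < ⊤} := by
    rw [Set.ofPred_forall]
    exact MeasurableSet.iInter fun k => (hlt k).compl
  have hpm : ∀ n, MeasurableSet {ω | p ω n} := fun n =>
    ((hlt m).inter (MeasurableSet.const _)).union (((hlt m).compl.inter (hlt n)).union htop)
  have hN : Measurable fun ω => Nat.find (hp ω) := measurable_find hp hpm
  refine ⟨fun ω => Nat.find (hp ω), hN, ?_, fun ω hω => ?_⟩
  · have hunc : Measurable fun q : Ω × ℕ => F q.2 q.1 :=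
      measurable_from_prod_countable_left fun n => hF n
    exact hunc.comp (measurable_id.prodMk hN)
  · obtain ⟨n, hn⟩ := hω
    rcases Nat.find_spec (hp ω) with h | h | h
    · exact ⟨by simpa only [h.2] using h.1, fun _ => h.2⟩
    · exact ⟨h.2, fun h' => absurd h' h.1⟩
    · exact absurd hn (h n)

variable {Ω : Type*} {d : ℕ} {H : MeasurableSpace Ω} [m₀ : MeasurableSpace Ω] {P : Measure Ω}
  [IsProbabilityMeasure P] {y Y : Ω → EuclideanSpace ℝ (Fin d)} {Z : Ω → ℝ}

local notation "E" => EuclideanSpace ℝ (Fin d)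

theorem measurable_hedgeEssSup (hH : H ≤ m₀) (θ : Ω → E) :
    Measurable[H] (hedgeEssSup H P Y Z θ) :=
  (isCondEssSup_condEssSup hH P _).measurable

theorem le_hedgeEssSup (hH : H ≤ m₀) (θ : Ω → E) :
    ∀ᵐ ω ∂P, ((Z ω - ⟪θ ω, Y ω⟫ : ℝ) : EReal) ≤ hedgeEssSup H P Y Z θ ω :=
  (isCondEssSup_condEssSup hH P _).le _ rfl

theorem hedgeEssSup_le (hH : H ≤ m₀) {θ : Ω → E} {ζ : Ω → EReal} (hζ : Measurable[H] ζ)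
    (h : ∀ᵐ ω ∂P, ((Z ω - ⟪θ ω, Y ω⟫ : ℝ) : EReal) ≤ ζ ω) :
    hedgeEssSup H P Y Z θ ≤ᵐ[P] ζ :=
  (isCondEssSup_condEssSup hH P _).least ζ hζ fun γ hγ => by rw [hγ]; exact h

theorem hedgeEssSup_le_of_superhedge (hH : H ≤ m₀) (hy : Measurable[H] y) {x : Ω → ℝ}
    (hx : Measurable[H] x) {θ : Ω → E} (hθ : Measurable[H] θ)
    (h : ∀ᵐ ω ∂P, Z ω ≤ x ω + ⟪θ ω, Y ω - y ω⟫) :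
    ∀ᵐ ω ∂P, hedgeEssSup H P Y Z θ ω ≤ ((x ω - ⟪θ ω, y ω⟫ : ℝ) : EReal) := by
  refine hedgeEssSup_le hH (hx.sub (hθ.inner hy)).coe_real_ereal ?_
  filter_upwards [h] with ω hω
  rw [EReal.coe_le_coe_iff]
  rw [inner_sub_right] at hω
  linarith

/-- The super-hedging prices are the costs of the cheapest super-hedges with a given strategy, plus
nonnegative amounts. -/
theorem superHedgingPrices_eq (hH : H ≤ m₀) (hy : Measurable[H] y) :
    superHedgingPrices H P y Y Z =
      {x : Ω → ℝ | Measurable[H] x ∧ ∃ θ : Ω → E, Measurable[H] θ ∧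
        ∃ r : Ω → ℝ, Measurable[H] r ∧ (∀ᵐ ω ∂P, 0 ≤ r ω) ∧
          ∀ᵐ ω ∂P, (x ω : EReal) =
            hedgeEssSup H P Y Z θ ω + ((⟪θ ω, y ω⟫ : ℝ) : EReal) + (r ω : EReal)} := by
  ext x
  refine and_congr_right fun hx => exists_congr fun θ => and_congr_right fun hθ => ?_
  constructor
  · intro h
    refine ⟨fun ω => x ω - ⟪θ ω, y ω⟫ - (hedgeEssSup H P Y Z θ ω).toReal,
      (hx.sub (hθ.inner hy)).sub (measurable_hedgeEssSup hH θ).ereal_toReal, ?_⟩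
    rw [← eventually_and]
    filter_upwards [hedgeEssSup_le_of_superhedge hH hy hx hθ h, le_hedgeEssSup hH θ] with ω h1 h2
    -- The essential supremum lies between two real numbers, so its `toReal` loses nothing.
    induction hs : hedgeEssSup H P Y Z θ ω with
    | bot => rw [hs] at h2; exact absurd h2 (not_le.2 (EReal.bot_lt_coe _))
    | top => rw [hs] at h1; exact absurd h1 (not_le.2 (EReal.coe_lt_top _))
    | coe s =>
      rw [hs, EReal.coe_le_coe_iff] at h1
      refine ⟨by simpa using h1, ?_⟩
      rw [EReal.toReal_coe, ← EReal.coe_add, ← EReal.coe_add]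
      congr 1
      ring
  · rintro ⟨r, -, hr0, h⟩
    filter_upwards [hr0, h, le_hedgeEssSup hH θ] with ω h1 h2 h3
    have h4 : ((Z ω - ⟪θ ω, Y ω⟫ + ⟪θ ω, y ω⟫ + r ω : ℝ) : EReal) ≤ x ω := by
      rw [h2, EReal.coe_add, EReal.coe_add]
      gcongr
    rw [EReal.coe_le_coe_iff] at h4
    rw [inner_sub_right]
    linarith

theorem superHedgingCost_le {x : Ω → ℝ} (hx : x ∈ superHedgingPrices H P y Y Z) :
    ∀ᵐ ω ∂P, superHedgingCost H P y Y Z ω ≤ (x ω : EReal) := by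
  have hmem : (fun ω => -(x ω : EReal)) ∈ (fun (γ : Ω → EReal) ω => -γ ω) ''
      ((fun (x : Ω → ℝ) ω => (x ω : EReal)) '' superHedgingPrices H P y Y Z) :=
    ⟨_, ⟨x, hx, rfl⟩, rfl⟩
  filter_upwards [(isCondEssSup_condEssSup le_rfl P _).le _ hmem] with ω hω
  exact EReal.neg_le_of_neg_le hω

theorem le_superHedgingCost {ζ : Ω → EReal} (hζ : Measurable ζ)
    (h : ∀ x ∈ superHedgingPrices H P y Y Z, ∀ᵐ ω ∂P, ζ ω ≤ (x ω : EReal)) :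
    ∀ᵐ ω ∂P, ζ ω ≤ superHedgingCost H P y Y Z ω := by
  have hub : ∀ γ ∈ (fun (γ : Ω → EReal) ω => -γ ω) ''
      ((fun (x : Ω → ℝ) ω => (x ω : EReal)) '' superHedgingPrices H P y Y Z),
      γ ≤ᵐ[P] fun ω => -ζ ω := by
    rintro _ ⟨_, ⟨x, hx, rfl⟩, rfl⟩
    filter_upwards [h x hx] with ω hω
    exact EReal.neg_le_neg_iff.2 hω
  filter_upwards [(isCondEssSup_condEssSup le_rfl P _).least _ hζ.neg hub] with ω hω
  exact EReal.le_neg_of_le_neg hω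

/-- The infimum super-hedging cost is the infimum over a dense sequence of constant strategies. -/
theorem superHedgingCost_ae_eq_iInf (hH : H ≤ m₀) (hy : Measurable[H] y)
    {g : Ω → E → EReal} {K : Ω → Set E}
    (hs : ∀ θ : Ω → E, Measurable[H] θ →
      ∀ᵐ ω ∂P, hedgeEssSup H P Y Z θ ω = tiltedSup (g ω) (K ω) (θ ω))
    (hK0 : ∀ᵐ ω ∂P, ∀ z ∈ K ω, ∀ i, 0 ≤ z i)
    (hfin : ∀ᵐ ω ∂P, ∃ θ, tiltedSup (g ω) (K ω) θ < ⊤) :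
    ∀ᵐ ω ∂P, superHedgingCost H P y Y Z ω =
      ⨅ θ, tiltedSup (g ω) (K ω) θ + ((⟪θ, y ω⟫ : ℝ) : EReal) := by
  let α : ℕ → E := TopologicalSpace.denseSeq E
  let F : ℕ → Ω → EReal := fun n ω =>
    hedgeEssSup H P Y Z (fun _ => α n) ω + ((⟪α n, y ω⟫ : ℝ) : EReal)
  have hFm : ∀ n, Measurable[H] (F n) := fun n =>
    (measurable_hedgeEssSup hH _).add (measurable_const.inner hy).coe_real_ereal
  have hF : ∀ᵐ ω ∂P, ⨅ n, F n ω =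
      ⨅ θ, tiltedSup (g ω) (K ω) θ + ((⟪θ, y ω⟫ : ℝ) : EReal) := by
    filter_upwards [ae_all_iff.2 fun n => hs (fun _ => α n) measurable_const, hK0] with ω h1 h2
    rw [iInf_tiltedSup_eq_iInf_denseSeq h2]
    exact iInf_congr fun n => by rw [← h1]
  have hle : ∀ᵐ ω ∂P, ⨅ n, F n ω ≤ superHedgingCost H P y Y Z ω := by
    refine le_superHedgingCost ((Measurable.iInf hFm).mono hH le_rfl) ?_
    rintro x ⟨hx, θ, hθ, h⟩
    filter_upwards [hF, hedgeEssSup_le_of_superhedge hH hy hx hθ h, hs θ hθ] with ω h1 h2 h3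
    rw [h1]
    refine iInf_le_of_le (θ ω) ?_
    rw [← h3]
    calc _ ≤ ((x ω - ⟪θ ω, y ω⟫ : ℝ) : EReal) + ((⟪θ ω, y ω⟫ : ℝ) : EReal) := by gcongr
      _ = x ω := by rw [← EReal.coe_add, sub_add_cancel]
  have hFtop : ∀ᵐ ω ∂P, ∃ n, F n ω < ⊤ := by
    filter_upwards [hF, hfin] with ω h1 ⟨θ, hθ⟩
    rw [← iInf_lt_iff, h1]
    exact (iInf_le _ θ).trans_lt (EReal.add_lt_top hθ.ne (EReal.coe_ne_top _))
  have hFle : ∀ᵐ ω ∂P, ∀ n, ((Z ω - ⟪α n, Y ω⟫ + ⟪α n, y ω⟫ : ℝ) : EReal) ≤ F n ω := by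
    filter_upwards [ae_all_iff.2 fun n => le_hedgeEssSup (P := P) (Y := Y) (Z := Z) hH
      (fun _ => α n)] with ω h n
    rw [EReal.coe_add]
    exact add_le_add_left (h n) _
  -- `F m` may be infinite on part of `Ω` and so fail to be a price. Using strategy `α m` where `F
  -- m` is finite and another finite index elsewhere gives a genuine price; where `F m = ⊤` the
  -- bound is trivial.
  have hge : ∀ m, ∀ᵐ ω ∂P, superHedgingCost H P y Y Z ω ≤ F m ω := fun m => by
    obtain ⟨N, hN, hFN, hNspec⟩ := @exists_measurable_index Ω H F hFm m
    have hreal : ∀ᵐ ω ∂P, ((F (N ω) ω).toReal : EReal) = F (N ω) ω := by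
      filter_upwards [hFtop, hFle] with ω h1 h2
      exact EReal.coe_toReal (hNspec ω h1).1.ne
        ((EReal.bot_lt_coe _).trans_le (h2 (N ω))).ne'
    have hmem : (fun ω => (F (N ω) ω).toReal) ∈ superHedgingPrices H P y Y Z := by
      refine ⟨hFN.ereal_toReal, fun ω => α (N ω), (measurable_of_countable α).comp hN, ?_⟩
      filter_upwards [hreal, hFle] with ω h1 h2
      have := h2 (N ω)
      rw [← h1, EReal.coe_le_coe_iff] at this
      rw [inner_sub_right]
      linarith
    filter_upwards [superHedgingCost_le hmem, hreal, hFtop] with ω h1 h2 h3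
    by_cases hm : F m ω < ⊤
    · rw [h2, (hNspec ω h3).2 hm] at h1
      exact h1
    · rw [not_lt_top_iff.1 hm]
      exact le_top
  filter_upwards [hF, hle, ae_all_iff.2 hge] with ω h1 h2 h3
  rw [← h1]
  exact (le_iInf h3).antisymm h2

end Pricing

/-- Subtracting the indicator only forces the value `⊥` off `C`, where it is already attained. -/
theorem affineInf_sub_indicatorFn {d : ℕ} {g : EuclideanSpace ℝ (Fin d) → EReal}
    {K C : Set (EuclideanSpace ℝ (Fin d))} {x : EuclideanSpace ℝ (Fin d)}
    (hC : x ∉ C → affineInf g K x = ⊥) : affineInf g K x - indicatorFn C x = affineInf g K x := by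
  by_cases hx : x ∈ C
  · rw [indicatorFn, if_pos hx, sub_zero]
  · rw [indicatorFn, if_neg hx, EReal.sub_top, hC hx]

end SuperHedging

end

/-! ### The main theorem -/

open SuperHedging in
theorem theorem2p6 {Ω : Type*} (H F : MeasurableSpace Ω) [m₀ : MeasurableSpace Ω]
    (P : Measure Ω) [IsProbabilityMeasure P]
    -- initial and final information: complete σ-algebras
    (hHF : H ≤ F) (hF : F ≤ m₀)
    (hHc : (P.trim (hHF.trans hF)).IsComplete) (hFc : (P.trim hF).IsComplete)
    -- initial and final prices of the risky assets
    {d : ℕ} (y Y : Ω → EuclideanSpace ℝ (Fin d)) (hy : Measurable[H] y) (hY : Measurable[F] Y)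
    (hy0 : ∀ᵐ ω ∂P, ∀ i, 0 ≤ y ω i) (hY0 : ∀ᵐ ω ∂P, ∀ i, 0 ≤ Y ω i)
    -- the claim `Z = g(Y)`, a real-valued random variable
    (g : Ω → EuclideanSpace ℝ (Fin d) → EReal) (Z : Ω → ℝ) (hZ : Measurable[F] Z)
    (hgZ : ∀ᵐ ω ∂P, g ω (Y ω) = (Z ω : EReal))
    -- any regular version of the conditional law of `Y` given `H`
    (κ : Kernel[H] Ω (EuclideanSpace ℝ (Fin d))) (hκ : IsRegularCondLaw H P Y κ) :
    -- the set of super-hedging prices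
    superHedgingPrices H P y Y Z =
      {x : Ω → ℝ | Measurable[H] x ∧ ∃ θ : Ω → EuclideanSpace ℝ (Fin d), Measurable[H] θ ∧
        ∃ r : Ω → ℝ, Measurable[H] r ∧ (∀ᵐ ω ∂P, 0 ≤ r ω) ∧
          ∀ᵐ ω ∂P, (x ω : EReal) =
            hedgeEssSup H P Y Z θ ω + ((⟪θ ω, y ω⟫ : ℝ) : EReal) + (r ω : EReal)} ∧
    (IsNormalIntegrand H g →
      -- the conditional essential supremum as a supremum over the conditional support
      (∀ θ : Ω → EuclideanSpace ℝ (Fin d), Measurable[H] θ →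
        ∀ᵐ ω ∂P,
          hedgeEssSup H P Y Z θ ω =
              (⨆ z ∈ lawSupport (κ ω), g ω z - ((⟪θ ω, z⟫ : ℝ) : EReal)) ∧
            (⨆ z ∈ lawSupport (κ ω), g ω z - ((⟪θ ω, z⟫ : ℝ) : EReal)) =
              conjugate (negOn (g ω) (lawSupport (κ ω))) (- θ ω)) ∧
      ((∀ᵐ ω ∂P, IsProper (g ω)) →
        (∀ᵐ ω ∂P, ∃ φ : EuclideanSpace ℝ (Fin d) → ℝ,
          ConcaveOn ℝ (convexHull ℝ (lawSupport (κ ω))) φ ∧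
            ∀ z ∈ convexHull ℝ (lawSupport (κ ω)), g ω z ≤ (φ z : EReal)) →
        ∀ᵐ ω ∂P,
          superHedgingCost H P y Y Z ω =
              - conjugate (conjugate (negOn (g ω) (lawSupport (κ ω)))) (y ω) ∧
          superHedgingCost H P y Y Z ω =
              uscHull (relConc (g ω) (lawSupport (κ ω))) (y ω)
                - indicatorFn (closure (convexHull ℝ (lawSupport (κ ω)))) (y ω) ∧
          superHedgingCost H P y Y Z ω =
              affineInf (g ω) (lawSupport (κ ω)) (y ω)
                - indicatorFn (closure (convexHull ℝ (lawSupport (κ ω)))) (y ω) ∧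
          -- the closure can be dropped unless `y` is in the closed convex hull of the conditional
          -- support without being in its convex hull
          ((y ω ∈ closure (convexHull ℝ (lawSupport (κ ω))) →
              y ω ∈ convexHull ℝ (lawSupport (κ ω))) →
            superHedgingCost H P y Y Z ω =
              uscHull (relConc (g ω) (lawSupport (κ ω))) (y ω)
                - indicatorFn (convexHull ℝ (lawSupport (κ ω))) (y ω) ∧
            superHedgingCost H P y Y Z ω =
              affineInf (g ω) (lawSupport (κ ω)) (y ω)
                - indicatorFn (convexHull ℝ (lawSupport (κ ω))) (y ω)))) := by
  have hH := hHF.trans hF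
  have hYm : Measurable Y := hY.mono hF le_rfl
  refine ⟨superHedgingPrices_eq hH hy, fun hg => ?_⟩
  have hs := fun (θ : Ω → EuclideanSpace ℝ (Fin d)) (hθ : Measurable[H] θ) =>
    hκ.hedgeEssSup_ae_eq hH hYm hg hgZ hθ
  refine ⟨fun θ hθ => ?_, fun hproper hφ => ?_⟩
  · filter_upwards [hs θ hθ] with ω hω
    exact ⟨hω, (conjugate_negOn_neg _ _ _).symm⟩
  have := hκ.1
  have hmaj : ∀ᵐ ω ∂P, ∃ (α : EuclideanSpace ℝ (Fin d)) (β : ℝ),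
      ∀ z ∈ lawSupport (κ ω), g ω z ≤ ((⟪α, z⟫ + β : ℝ) : EReal) := by
    filter_upwards [hφ] with ω ⟨φ, hφc, hgφ⟩
    obtain ⟨α, β, h⟩ := hφc.exists_affine_majorant (lawSupport_nonempty (κ ω)).convexHull
    refine ⟨α, β, fun z hz => ?_⟩
    have hz' := subset_convexHull ℝ _ hz
    exact (hgφ z hz').trans (EReal.coe_le_coe_iff.2 (h z hz'))
  have horthant : IsClosed {z : EuclideanSpace ℝ (Fin d) | ∀ i, 0 ≤ z i} := by
    rw [Set.ofPred_forall]
    exact isClosed_iInter fun i =>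
      isClosed_le continuous_const (EuclideanSpace.proj (𝕜 := ℝ) i).continuous
  have hcost := superHedgingCost_ae_eq_iInf hH hy hs
    (hκ.ae_forall_mem_of_isClosed hH hYm horthant hY0)
    (hmaj.mono fun ω ⟨α, β, h⟩ => ⟨α, (tiltedSup_le_coe_iff.2 h).trans_lt (EReal.coe_lt_top β)⟩)
  filter_upwards [hcost, hmaj, hproper] with ω hω hmajω hprop
  have hne := lawSupport_nonempty (κ ω)
  have hbot : ∀ z ∈ lawSupport (κ ω), ⊥ < g ω z := fun z _ => hprop.2 z
  have hcl : y ω ∉ closure (convexHull ℝ (lawSupport (κ ω))) →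
      affineInf (g ω) (lawSupport (κ ω)) (y ω) = ⊥ := fun h => affineInf_eq_bot h hmajω
  have haff := hω.trans (affineInf_eq_iInf hne hbot (y ω)).symm
  rw [uscHull_relConc_eq_affineInf hne hbot hmajω]
  refine ⟨hω.trans (neg_biconjugate_negOn _ _ _).symm, ?_, ?_, fun h => ⟨?_, ?_⟩⟩
  · rw [affineInf_sub_indicatorFn hcl, haff]
  · rw [affineInf_sub_indicatorFn hcl, haff]
  -- By the contrapositive of `h`, a point `y ω` outside the convex hull is outside its closure,
  -- where the value is `⊥`.
  · rw [affineInf_sub_indicatorFn fun h' => hcl (mt h h'), haff]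
  · rw [affineInf_sub_indicatorFn fun h' => hcl (mt h h'), haff]
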